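/- Let $(S,\mathfrak m,k)$ and $(T,\mathfrak n,k)$ be commutative Noetherian local rings with common residue field $k$, neither of which is a field, let $\pi_S\colon S\to k$ and $\pi_T\colon T\to k$ be the natural surjections, and let $R=S\times_k T=\{(s,t)\in S\times T : \pi_S(s)=\pi_T(t)\}$ be their fiber product. Let $M$ be a finitely generated $R$-module and let $Y$ be a nonzero finitely generated $S$-module, regarded as an $R$-module via the projection $R\to S$, $(s,t)\mapsto s$. Assume that $\operatorname{Tor}^R_m(Y,M)=0$ for some integer $m\ge 4$, and that at least one of the following holds: (1) $T$ is not a discrete valuation ring; (2) $Y$ is not a free $S$-module. Then $\operatorname{pd}_R M\le 1$. If, in addition, $S$ or $T$ has depth $0$, then $M$ is a free $R$-module. -/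

import Mathlib

universe u

open CategoryTheory

/-- A commutative ring is a DVR: it is an integral domain and a discrete valuation ring
(in particular it is not a field). -/
def IsDVR (A : Type u) [CommRing A] : Prop :=
  ∃ _ : IsDomain A, IsDiscreteValuationRing A

/-- The depth of a local ring `A`: the supremum of the lengths of the `A`-regular sequences
consisting of elements of the maximal ideal. -/
noncomputable def localRingDepth (A : Type u) [CommRing A] [IsLocalRing A] : ℕ∞ :=
  ⨆ (rs : List A) (_ : ∀ r ∈ rs, r ∈ IsLocalRing.maximalIdeal A)
    (_ : RingTheory.Sequence.IsRegular A rs), (rs.length : ℕ∞)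

/-! Put `I = ker (R → T)` (a copy of the maximal ideal of `S`) and `J = ker (R → S)` (a copy of that
of `T`). Both are nonzero, `I ⊓ J = ⊥`, and `I ⊔ J` is the maximal ideal of `R`. Hence, from the
second syzygy on, every syzygy in a minimal free resolution of `M` splits into a part in `Iⁿ` and a
part in `Jⁿ` (`LinearMap.isSplitAlong_ker`).

Dimension shifting turns the vanishing of Tor into injectivity of `Y ⊗ P → Y ⊗ Rʰ` for some later
syzygy `P`. As `J` kills `Y`, Nakayama forces `P ≤ Iʰ`. Containment then propagates down the
resolution, alternating between `I` and `J` (`Submodule.IsSplitAlong.range_le`). So either a syzygy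
vanishes, and then so do the earlier ones down to the second, making the first syzygy free; or there
is an exact sequence `0 → Iʰ → Rʰ → Jᵍ → 0` with `g > 0` whose left map stays injective after
tensoring with `Y`.

The second alternative is excluded: it makes a power of the maximal ideal of `T` free over `T`, so
`T` is a DVR, and it makes `Y` flat, hence free, over `S`. In depth `0` a socle element of `S` or
`T` lifts to one of `R`, which rules out a nonzero free first syzygy in a minimal cover. -/

/-! ### Dimension shifting for left derived functors -/

section Splice

open Limits

universe v v' w'

variable {C : Type w'} [Category.{v} C] [Abelian C]

/-- The augmentation of a projective resolution. -/
noncomputable def CategoryTheory.ProjectiveResolution.augmentation {X : C}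
    (Q : ProjectiveResolution X) : Q.complex.X 0 ⟶ X := Q.π.f 0

lemma CategoryTheory.ProjectiveResolution.d_comp_augmentation {X : C}
    (Q : ProjectiveResolution X) : Q.complex.d 1 0 ≫ Q.augmentation = 0 :=
  Q.complex_d_comp_π_f_zero

lemma CategoryTheory.ProjectiveResolution.exact_augmentation {X : C}
    (Q : ProjectiveResolution X) :
    (ShortComplex.mk _ _ Q.d_comp_augmentation).Exact :=
  ShortComplex.exact_of_g_is_cokernel _ Q.isColimitCokernelCofork

instance {X : C} (Q : ProjectiveResolution X) : Epi Q.augmentation :=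
  inferInstanceAs (Epi (Q.π.f 0))

variable {S : ShortComplex C}

lemma CategoryTheory.ProjectiveResolution.exact_augmentation_comp (hS : S.ShortExact)
    (Q : ProjectiveResolution S.X₁) :
    (ShortComplex.mk (Q.complex.d 1 0) (Q.augmentation ≫ S.f)
      (by rw [← Category.assoc, Q.d_comp_augmentation, zero_comp])).Exact := by
  have := hS.mono_f
  let φ : ShortComplex.mk _ _ Q.d_comp_augmentation ⟶
      ShortComplex.mk (Q.complex.d 1 0) (Q.augmentation ≫ S.f)
      (by rw [← Category.assoc, Q.d_comp_augmentation, zero_comp]) :=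
    { τ₁ := 𝟙 _, τ₂ := 𝟙 _, τ₃ := S.f }
  have : Epi φ.τ₁ := inferInstanceAs (Epi (𝟙 _))
  have : IsIso φ.τ₂ := inferInstanceAs (IsIso (𝟙 _))
  have : Mono φ.τ₃ := inferInstanceAs (Mono S.f)
  exact (ShortComplex.exact_iff_of_epi_of_isIso_of_mono φ).1 Q.exact_augmentation

lemma CategoryTheory.ProjectiveResolution.exact_augmentation_comp_right (hS : S.ShortExact)
    (Q : ProjectiveResolution S.X₁) :
    (ShortComplex.mk (Q.augmentation ≫ S.f) S.g (by simp)).Exact := by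
  let φ : ShortComplex.mk (Q.augmentation ≫ S.f) S.g (by simp) ⟶ S :=
    { τ₁ := Q.augmentation, τ₂ := 𝟙 _, τ₃ := 𝟙 _ }
  have : Epi φ.τ₁ := inferInstanceAs (Epi Q.augmentation)
  have : IsIso φ.τ₂ := inferInstanceAs (IsIso (𝟙 _))
  have : Mono φ.τ₃ := inferInstanceAs (Mono (𝟙 _))
  exact (ShortComplex.exact_iff_of_epi_of_isIso_of_mono φ).2 hS.exact

/-- Splicing a short exact sequence `0 ⟶ K ⟶ F ⟶ X ⟶ 0` with `F` projective and a projective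
resolution of `K` gives a projective resolution of `X`. -/
noncomputable def CategoryTheory.ProjectiveResolution.splice
    (hS : S.ShortExact) [Projective S.X₂] (Q : ProjectiveResolution S.X₁) :
    ProjectiveResolution S.X₃ where
  complex := Q.complex.augment (Q.augmentation ≫ S.f)
    (by rw [← Category.assoc, Q.d_comp_augmentation, zero_comp])
  projective n := by
    cases n
    · exact ‹Projective S.X₂›
    · exact Q.projective _
  π := (ChainComplex.toSingle₀Equiv _ _).symm ⟨S.g, by
    exact (by simp : (Q.augmentation ≫ S.f) ≫ S.g = 0)⟩
  quasiIso := ⟨fun n => by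
    have hep := hS.epi_g
    cases n with
    | zero =>
      rw [ChainComplex.quasiIsoAt₀_iff, ShortComplex.quasiIso_iff_of_zeros']
      · refine (ShortComplex.exact_and_epi_g_iff_of_iso ?_).2
          ⟨Q.exact_augmentation_comp_right hS, hep⟩
        exact ShortComplex.isoMk (Iso.refl _) (Iso.refl _) (Iso.refl _)
          ((Category.id_comp _).trans (Category.comp_id _).symm)
          ((Category.id_comp _).trans (Eq.trans
            (ChainComplex.toSingle₀Equiv_symm_apply_f_zero (C := Q.complex.augment
              (Q.augmentation ≫ S.f) _) S.g _).symm (Category.comp_id _).symm))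
      all_goals rfl
    | succ n =>
      rw [quasiIsoAt_iff_exactAt']
      · rw [HomologicalComplex.exactAt_iff' _ (n + 1 + 1) (n + 1) n (by simp) (by simp)]
        cases n with
        | zero => exact Q.exact_augmentation_comp hS
        | succ n => exact Q.exact_succ n
      · apply ChainComplex.exactAt_succ_single_obj⟩

variable {D : Type v'} [Category.{v} D] [Abelian D] [HasProjectiveResolutions C]
  (F : C ⥤ D) [F.Additive]

lemma CategoryTheory.ProjectiveResolution.isZero_leftDerived_obj_succ_iff {X : C}
    (P : ProjectiveResolution X) (n : ℕ) :
    IsZero ((F.leftDerived (n + 1)).obj X) ↔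
      (ShortComplex.mk (F.map (P.complex.d (n + 2) (n + 1))) (F.map (P.complex.d (n + 1) n))
        (by rw [← F.map_comp, P.complex.d_comp_d, F.map_zero])).Exact := by
  rw [(P.isoLeftDerivedObj F (n + 1)).isZero_iff]
  erw [← HomologicalComplex.exactAt_iff_isZero_homology]
  rw [HomologicalComplex.exactAt_iff' _ (n + 1 + 1) (n + 1) n (by simp) (by simp)]
  rfl

/-- Dimension shifting for left derived functors. -/
lemma CategoryTheory.ShortComplex.ShortExact.isZero_leftDerived_obj_iff (hS : S.ShortExact)
    [Projective S.X₂] (n : ℕ) :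
    IsZero ((F.leftDerived (n + 2)).obj S.X₃) ↔ IsZero ((F.leftDerived (n + 1)).obj S.X₁) := by
  rw [((projectiveResolution S.X₁).splice hS).isZero_leftDerived_obj_succ_iff F,
    (projectiveResolution S.X₁).isZero_leftDerived_obj_succ_iff F]
  -- The differentials of the spliced complex are those of the old resolution, shifted by one
  -- degree.
  rfl

/-- An element killed by `F.map S.f` lifts along the epimorphism `F.map Q.augmentation` to a cycle
of the spliced complex. Vanishing in degree one makes it a boundary, and the augmentation kills
boundaries. -/
lemma CategoryTheory.ShortComplex.ShortExact.mono_map_of_isZero_leftDerived_one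
    [PreservesFiniteColimits F] (hS : S.ShortExact) [Projective S.X₂]
    (h : IsZero ((F.leftDerived 1).obj S.X₃)) : Mono (F.map S.f) := by
  let Q := projectiveResolution S.X₁
  have h1 : (ShortComplex.mk (F.map (Q.complex.d 1 0)) (F.map (Q.augmentation ≫ S.f))
      (by rw [← F.map_comp, ← Category.assoc, Q.d_comp_augmentation, zero_comp,
        F.map_zero])).Exact := (Q.splice hS).isZero_leftDerived_obj_succ_iff F 0 |>.1 h
  rw [Preadditive.mono_iff_cancel_zero]
  intro A f hf
  obtain ⟨A', p, hp, x, hx⟩ := surjective_up_to_refinements_of_epi (F.map Q.augmentation) f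
  obtain ⟨A'', p', hp', y, hy⟩ := h1.exact_up_to_refinements x
    ((congrArg (x ≫ ·) (F.map_comp _ _)).trans
      (by rw [← Category.assoc, ← hx, Category.assoc, hf, comp_zero]))
  rw [← cancel_epi p, ← cancel_epi p', hx, ← Category.assoc, hy]
  dsimp
  rw [Category.assoc, ← F.map_comp, Q.d_comp_augmentation, F.map_zero]
  simp

end Splice

/-! ### Tor of modules and syzygies -/

section TorModule
open Limits

variable {R : Type u} [CommRing R] (Y : Type u) [AddCommGroup Y] [Module R Y]
  {F M : Type u} [AddCommGroup F] [Module R F] [AddCommGroup M] [Module R M]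

lemma LinearMap.shortExact_ker (φ : F →ₗ[R] M) (hφ : Function.Surjective φ) :
    (ShortComplex.mk (ModuleCat.ofHom (LinearMap.ker φ).subtype) (ModuleCat.ofHom φ)
      (by ext x; exact x.2)).ShortExact where
  exact := by
    rw [ShortComplex.moduleCat_exact_iff]
    intro x hx
    exact ⟨⟨x, hx⟩, rfl⟩
  mono_f := (ModuleCat.mono_iff_injective _).2 Subtype.val_injective
  epi_g := (ModuleCat.epi_iff_surjective _).2 hφ

/-- `TorVanishes Y M n` says that `Tor_n (Y, M) = 0`. -/
def TorVanishes (Y M : Type u) [AddCommGroup Y] [Module R Y] [AddCommGroup M] [Module R M]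
    (n : ℕ) : Prop :=
  IsZero (((Tor (ModuleCat.{u} R) n).obj (ModuleCat.of R Y)).obj (ModuleCat.of R M))

variable {Y} [Module.Projective R F]

lemma TorVanishes.ker {n : ℕ} (h : TorVanishes (R := R) Y M (n + 2)) (φ : F →ₗ[R] M)
    (hφ : Function.Surjective φ) : TorVanishes (R := R) Y (LinearMap.ker φ) (n + 1) := by
  have : Projective (ModuleCat.of R F) := ModuleCat.projective_of_categoryTheory_projective _
  exact ((φ.shortExact_ker hφ).isZero_leftDerived_obj_iff _ n).1 h

lemma TorVanishes.lTensor_injective (h : TorVanishes (R := R) Y M 1) (φ : F →ₗ[R] M)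
    (hφ : Function.Surjective φ) :
    Function.Injective ((LinearMap.ker φ).subtype.lTensor Y) := by
  have := (φ.shortExact_ker hφ).mono_map_of_isZero_leftDerived_one
   ((MonoidalCategory.tensoringLeft (ModuleCat.{u} R)).obj (ModuleCat.of R Y)) h
  exact (ModuleCat.mono_iff_injective _).1 this

end TorModule

/-! ### Nakayama and minimal covers over a local ring -/

section LocalModules

open TensorProduct

variable {R : Type*} [CommRing R] [IsLocalRing R]

/-- After base change to the residue field this concerns vector spaces, where a nonzero tensor
factor is faithfully flat; Nakayama transfers the result back. -/
lemma IsLocalRing.subsingleton_right_of_subsingleton_tensorProduct {Y Z : Type*}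
    [AddCommGroup Y] [Module R Y] [Module.Finite R Y] [Nontrivial Y]
    [AddCommGroup Z] [Module R Z] [Module.Finite R Z] (h : Subsingleton (Y ⊗[R] Z)) :
    Subsingleton Z := by
  let k := IsLocalRing.ResidueField R
  have hY : Nontrivial (k ⊗[R] Y) := by
    rw [← not_subsingleton_iff_nontrivial, IsLocalRing.subsingleton_tensorProduct,
      not_subsingleton_iff_nontrivial]
    infer_instance
  have h1 : Subsingleton (k ⊗[R] (Y ⊗[R] Z)) := inferInstance
  have h2 : Subsingleton ((k ⊗[R] Y) ⊗[k] (k ⊗[R] Z)) :=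
    (AlgebraTensorModule.distribBaseChange R k Y Z).symm.toEquiv.subsingleton
  rw [Module.FaithfullyFlat.subsingleton_tensorProduct_iff_right] at h2
  exact IsLocalRing.subsingleton_tensorProduct.1 h2

/-- A finite module over a local ring has a minimal free cover. -/
lemma IsLocalRing.exists_minimal_cover (M : Type*) [AddCommGroup M] [Module R M]
    [Module.Finite R M] :
    ∃ (n : ℕ) (φ : (Fin n → R) →ₗ[R] M), Function.Surjective φ ∧
      ∀ x ∈ LinearMap.ker φ, ∀ i, x i ∈ IsLocalRing.maximalIdeal R := by
  classical
  have hex : ∃ n : ℕ, ∃ v : Fin n → M, Submodule.span R (Set.range v) = ⊤ :=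
    Module.Finite.exists_fin
  obtain ⟨v, hv⟩ := Nat.find_spec hex
  have hmin := @Nat.find_min _ _ hex
  generalize Nat.find hex = n at *
  refine ⟨n, Fintype.linearCombination R v, ?_, ?_⟩
  · rw [← LinearMap.range_eq_top, Fintype.range_linearCombination, hv]
  · intro x hx i
    by_contra hi
    cases n with
    | zero => exact i.elim0
    | succ n =>
    -- A relation with a unit coefficient makes the generator `v i` redundant, against minimality of
    -- the number of generators.
    refine hmin (Nat.lt_succ_self n) ⟨v ∘ i.succAbove, ?_⟩
    have hu : IsUnit (x i) := by simpa using hi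
    obtain ⟨u, hu⟩ := hu
    rw [LinearMap.mem_ker, Fintype.linearCombination_apply, Fin.sum_univ_succAbove _ i, ← hu] at hx
    have hvi : v i ∈ Submodule.span R (Set.range (v ∘ i.succAbove)) := by
      have : (u : R) • v i ∈ Submodule.span R (Set.range (v ∘ i.succAbove)) := by
        rw [eq_neg_of_add_eq_zero_left hx]
        exact Submodule.neg_mem _ (Submodule.sum_mem _ fun j _ =>
          Submodule.smul_mem _ _ (Submodule.subset_span ⟨j, rfl⟩))
      simpa [smul_smul] using Submodule.smul_mem _ (↑u⁻¹ : R) this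
    rw [eq_top_iff, ← hv, Submodule.span_le]
    rintro _ ⟨j, rfl⟩
    rcases Fin.eq_self_or_eq_succAbove i j with rfl | ⟨j, rfl⟩
    · exact hvi
    · exact Submodule.subset_span ⟨j, rfl⟩

end LocalModules

/-! ### Syzygies split along two ideals with zero intersection -/

section FiberProduct

open TensorProduct

variable {R : Type u} [CommRing R]

/-- The submodule `Iⁿ` of `Rⁿ`. -/
def Ideal.finPow (I : Ideal R) (n : ℕ) : Submodule R (Fin n → R) :=
  Submodule.pi Set.univ fun _ => I

lemma Ideal.mem_finPow {I : Ideal R} {n : ℕ} {x : Fin n → R} :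
    x ∈ I.finPow n ↔ ∀ i, x i ∈ I := by
  simp [Ideal.finPow]

lemma LinearMap.apply_eq_sum_smul_single {n : ℕ} {M : Type*} [AddCommGroup M] [Module R M]
    (φ : (Fin n → R) →ₗ[R] M) (x : Fin n → R) : φ x = ∑ i, x i • φ (Pi.single i 1) := by
  conv_lhs => rw [pi_eq_sum_univ' x]
  simp only [map_sum, map_smul]

lemma LinearMap.apply_mem_smul_range {I : Ideal R} {n : ℕ} {M : Type*} [AddCommGroup M]
    [Module R M] (φ : (Fin n → R) →ₗ[R] M) {x : Fin n → R} (hx : x ∈ I.finPow n) :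
    φ x ∈ I • LinearMap.range φ := by
  rw [φ.apply_eq_sum_smul_single]
  exact Submodule.sum_mem _ fun i _ => Submodule.smul_mem_smul (Ideal.mem_finPow.1 hx i) ⟨_, rfl⟩

lemma Ideal.smul_le_finPow (I : Ideal R) {n : ℕ} (N : Submodule R (Fin n → R)) :
    I • N ≤ I.finPow n :=
  Submodule.smul_le.2 fun _ hr _ _ => Ideal.mem_finPow.2 fun _ => I.mul_mem_right _ hr

lemma LinearMap.apply_mem_finPow {I : Ideal R} {n p : ℕ} (φ : (Fin n → R) →ₗ[R] (Fin p → R))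
    {x : Fin n → R} (hx : x ∈ I.finPow n) : φ x ∈ I.finPow p :=
  I.smul_le_finPow _ (φ.apply_mem_smul_range hx)

lemma Ideal.finPow_inf_finPow {I J : Ideal R} (h : I ⊓ J = ⊥) (n : ℕ) :
    I.finPow n ⊓ J.finPow n = ⊥ := by
  rw [eq_bot_iff]
  rintro x ⟨hI, hJ⟩
  ext i
  exact (h ▸ (⟨Ideal.mem_finPow.1 hI i, Ideal.mem_finPow.1 hJ i⟩ : x i ∈ I ⊓ J) :
    x i ∈ (⊥ : Ideal R))

lemma Ideal.smul_finPow {I J : Ideal R} (h : I ⊓ J = ⊥) (n : ℕ) : I • J.finPow n = ⊥ := by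
  rw [eq_bot_iff, ← Ideal.finPow_inf_finPow h n]
  exact le_inf (I.smul_le_finPow _) Submodule.smul_le_right

/-- A submodule of `Rⁿ` is split along `I` and `J` if it is the sum of its intersections with
`Iⁿ` and `Jⁿ`. -/
def Submodule.IsSplitAlong {n : ℕ} (N : Submodule R (Fin n → R)) (I J : Ideal R) : Prop :=
  N ≤ (N ⊓ I.finPow n) ⊔ (N ⊓ J.finPow n)

variable {I J : Ideal R}

lemma Submodule.IsSplitAlong.symm {n : ℕ} {N : Submodule R (Fin n → R)}
    (h : N.IsSplitAlong I J) : N.IsSplitAlong J I := by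
  rwa [Submodule.IsSplitAlong, sup_comm]

lemma Submodule.inf_finPow_eq_bot_of_le {n : ℕ} {N : Submodule R (Fin n → R)}
    (hIJ : I ⊓ J = ⊥) (h : N ≤ J.finPow n) : N ⊓ I.finPow n = ⊥ := by
  rw [eq_bot_iff, ← Ideal.finPow_inf_finPow hIJ n]
  exact fun x hx => ⟨hx.2, h hx.1⟩

variable [IsLocalRing R]

/-- Write a kernel element as `a + b` with `a ∈ Iⁿ`, `b ∈ Jⁿ`. Then `φ a = -φ b` lies in `Iᵖ ⊓ Jᵖ =
⊥`, so both summands are in the kernel. -/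
lemma LinearMap.isSplitAlong_ker {n p : ℕ} (φ : (Fin n → R) →ₗ[R] (Fin p → R))
    (hIJ : I ⊓ J = ⊥) (hsup : I ⊔ J = IsLocalRing.maximalIdeal R)
    (hφ : LinearMap.ker φ ≤ (IsLocalRing.maximalIdeal R).finPow n) :
    (LinearMap.ker φ).IsSplitAlong I J := by
  intro x hx
  have h := fun i => Submodule.mem_sup.1 (hsup.ge (Ideal.mem_finPow.1 (hφ hx) i))
  choose a ha b hb hab using h
  have hab' : x = a + b := funext fun i => (hab i).symm
  have hsum : φ a + φ b = 0 := by rw [← map_add, ← hab']; exact hx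
  have hbJ := φ.apply_mem_finPow (Ideal.mem_finPow.2 hb)
  have haI := φ.apply_mem_finPow (Ideal.mem_finPow.2 ha)
  have ha0 : φ a = 0 := by
    have : φ a ∈ I.finPow p ⊓ J.finPow p := by
      refine ⟨haI, ?_⟩
      rw [eq_neg_of_add_eq_zero_left hsum]
      exact Submodule.neg_mem _ hbJ
    rwa [Ideal.finPow_inf_finPow hIJ] at this
  have hb0 : φ b = 0 := by rwa [ha0, zero_add] at hsum
  rw [hab']
  exact Submodule.add_mem_sup ⟨ha0, Ideal.mem_finPow.2 ha⟩ ⟨hb0, Ideal.mem_finPow.2 hb⟩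

variable [IsNoetherianRing R]

/-- If `φ g ∈ Iᵖ` and `g` had a unit coordinate, then for nonzero `j ∈ J` the vector `j • g` would
be a nonzero element of `ker φ ⊓ Jⁿ`. So the `I`-part of the range lies in the maximal ideal times
the range, and Nakayama leaves only the `J`-part. -/
lemma Submodule.IsSplitAlong.range_le {n p : ℕ} {φ : (Fin n → R) →ₗ[R] (Fin p → R)}
    (hφ : (LinearMap.range φ).IsSplitAlong I J) (hIJ : I ⊓ J = ⊥) (hJ : J ≠ ⊥)
    (hker : LinearMap.ker φ ⊓ J.finPow n = ⊥) : LinearMap.range φ ≤ J.finPow p := by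
  have key : LinearMap.range φ ⊓ I.finPow p ≤
      IsLocalRing.maximalIdeal R • LinearMap.range φ := by
    rintro _ ⟨⟨g, rfl⟩, hg⟩
    refine φ.apply_mem_smul_range (Ideal.mem_finPow.2 fun i => ?_)
    by_contra hi
    have hu : IsUnit (g i) := by simpa using hi
    refine hJ (eq_bot_iff.2 fun j hj => ?_)
    have h1 : j • g ∈ LinearMap.ker φ ⊓ J.finPow n := by
      refine ⟨?_, Ideal.mem_finPow.2 fun _ => J.mul_mem_right _ hj⟩
      rw [SetLike.mem_coe, LinearMap.mem_ker, map_smul]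
      have := Submodule.smul_mem_smul hj hg
      rwa [Ideal.smul_finPow (by rwa [inf_comm])] at this
    rw [hker] at h1
    exact hu.mul_left_eq_zero.1 (congrFun h1 i)
  refine le_trans (Submodule.le_of_le_smul_of_le_jacobson_bot (I := IsLocalRing.maximalIdeal R)
    (N := LinearMap.range φ ⊓ J.finPow p) (IsNoetherian.noetherian _)
    (IsLocalRing.maximalIdeal_le_jacobson _) ?_) inf_le_right
  rw [sup_comm]
  exact hφ.trans (sup_le_sup_right key _)

lemma Submodule.IsSplitAlong.range_eq_bot {n p : ℕ} {φ : (Fin n → R) →ₗ[R] (Fin p → R)}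
    (hφ : (LinearMap.range φ).IsSplitAlong I J) (hIJ : I ⊓ J = ⊥) (hI : I ≠ ⊥) (hJ : J ≠ ⊥)
    (hker : LinearMap.ker φ = ⊥) : LinearMap.range φ = ⊥ := by
  rw [eq_bot_iff, ← Ideal.finPow_inf_finPow hIJ]
  exact le_inf (hφ.symm.range_le (by rwa [inf_comm]) hI (by rw [hker, bot_inf_eq]))
    (hφ.range_le hIJ hJ (by rw [hker, bot_inf_eq]))

/-- For `p` in the `J`-part of `P`, `y ⊗ p` dies in `Y ⊗ Rⁿ` because `J` kills `Y`, hence is already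
zero. So `Y ⊗ P / (P ⊓ Iⁿ) = 0`, and Nakayama applies. -/
lemma Submodule.IsSplitAlong.le_finPow_of_lTensor_injective {n : ℕ}
    {P : Submodule R (Fin n → R)} (hP : P.IsSplitAlong I J)
    {Y : Type*} [AddCommGroup Y] [Module R Y] [Module.Finite R Y] [Nontrivial Y]
    (hJY : ∀ j ∈ J, ∀ y : Y, j • y = 0) (hinj : Function.Injective (P.subtype.lTensor Y)) :
    P ≤ I.finPow n := by
  let Q : Submodule R P := (P ⊓ I.finPow n).comap P.subtype
  have hzero : ∀ (y : Y) (p : P), (p : Fin n → R) ∈ J.finPow n → y ⊗ₜ[R] p = 0 := by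
    intro y p hp
    apply hinj
    rw [LinearMap.lTensor_tmul, map_zero, Submodule.subtype_apply, pi_eq_sum_univ' (p : Fin n → R),
      TensorProduct.tmul_sum]
    refine Finset.sum_eq_zero fun i _ => ?_
    rw [← TensorProduct.smul_tmul, hJY _ (Ideal.mem_finPow.1 hp i), TensorProduct.zero_tmul]
  have hsub : Subsingleton (Y ⊗[R] (P ⧸ Q)) := by
    refine subsingleton_of_forall_eq 0 fun z => ?_
    induction z with
    | zero => rfl
    | add a b ha hb => rw [ha, hb, add_zero]
    | tmul y q =>
      obtain ⟨p, rfl⟩ := Q.mkQ_surjective q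
      obtain ⟨a, ha, b, hb, hab⟩ := Submodule.mem_sup.1 (hP p.2)
      have h1 : Q.mkQ p = Q.mkQ ⟨b, hb.1⟩ := by
        refine (Submodule.Quotient.eq Q).2 ?_
        change (p : Fin n → R) - b ∈ P ⊓ I.finPow n
        rwa [← hab, add_sub_cancel_right]
      have h2 := congrArg (Q.mkQ.lTensor Y) (hzero y ⟨b, hb.1⟩ hb.2)
      rwa [LinearMap.lTensor_tmul, map_zero, ← h1] at h2
  have := IsLocalRing.subsingleton_right_of_subsingleton_tensorProduct hsub
  rw [Submodule.Quotient.subsingleton_iff] at this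
  intro x hx
  have : (⟨x, hx⟩ : P) ∈ Q := this ▸ Submodule.mem_top
  exact this.2

/-- There is a free presentation `R^h → J^g` with `g > 0` and kernel `I^h` that stays left exact
after tensoring with `Y`. -/
def HasPureFreePresentation (I J : Ideal R) (Y : Type*) [AddCommGroup Y] [Module R Y] : Prop :=
  ∃ (h g : ℕ) (d : (Fin h → R) →ₗ[R] (Fin g → R)), 0 < g ∧
    LinearMap.ker d = I.finPow h ∧ LinearMap.range d = J.finPow g ∧
    Function.Injective ((I.finPow h).subtype.lTensor Y)

variable {Y : Type u} [AddCommGroup Y] [Module R Y] [Module.Finite R Y] [Nontrivial Y]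

/-- The containments `ker d₁ ≤ Iʰ`, `range d₁ ≤ Jᵍ`, `range d₂ ≤ Iᶠ` follow one from another. As `I`
and `J` annihilate each other, the first two are then equalities. -/
lemma range_eq_bot_or_hasPureFreePresentation (hIJ : I ⊓ J = ⊥)
    (hI : I ≠ ⊥) (hJ : J ≠ ⊥) (hJY : ∀ j ∈ J, ∀ y : Y, j • y = 0)
    {h g f : ℕ} (d₁ : (Fin h → R) →ₗ[R] (Fin g → R)) (d₂ : (Fin g → R) →ₗ[R] (Fin f → R))
    (hd : LinearMap.range d₁ = LinearMap.ker d₂)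
    (h₁ : (LinearMap.ker d₁).IsSplitAlong I J) (h₂ : (LinearMap.range d₁).IsSplitAlong I J)
    (h₃ : (LinearMap.range d₂).IsSplitAlong I J)
    (hinj : Function.Injective ((LinearMap.ker d₁).subtype.lTensor Y)) :
    LinearMap.range d₂ = ⊥ ∨ HasPureFreePresentation I J Y := by
  have hJI : J ⊓ I = ⊥ := by rwa [inf_comm]
  have hker : LinearMap.ker d₁ ≤ I.finPow h := h₁.le_finPow_of_lTensor_injective hJY hinj
  have hran : LinearMap.range d₁ ≤ J.finPow g :=
    h₂.range_le hIJ hJ (Submodule.inf_finPow_eq_bot_of_le hJI hker)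
  have hran₂ : LinearMap.range d₂ ≤ I.finPow f := by
    refine h₃.symm.range_le hJI hI ?_
    rw [← hd]
    exact Submodule.inf_finPow_eq_bot_of_le hIJ hran
  rcases Nat.eq_zero_or_pos g with rfl | hg
  · left
    rw [LinearMap.range_eq_bot]
    exact Subsingleton.elim _ _
  right
  have hker' : LinearMap.ker d₁ = I.finPow h := by
    refine le_antisymm hker fun x hx => ?_
    have := Submodule.smul_mono (le_refl I) hran (d₁.apply_mem_smul_range hx)
    rwa [Ideal.smul_finPow hIJ] at this
  refine ⟨h, g, d₁, hg, hker', le_antisymm hran fun x hx => ?_, hker' ▸ hinj⟩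
  rw [hd]
  have := Submodule.smul_mono (le_refl J) hran₂ (d₂.apply_mem_smul_range hx)
  rwa [Ideal.smul_finPow hJI] at this

/-- Induction on the Tor index. In the base case, index `2`, one shift leaves `Tor₁` of the next
syzygy, which yields the required injectivity. In the inductive step, a vanishing next syzygy makes
`N` the split image of an injective map of free modules, hence zero. -/
lemma Submodule.IsSplitAlong.eq_bot_of_torVanishes (hIJ : I ⊓ J = ⊥)
    (hsup : I ⊔ J = IsLocalRing.maximalIdeal R)
    (hI : I ≠ ⊥) (hJ : J ≠ ⊥) (hJY : ∀ j ∈ J, ∀ y : Y, j • y = 0) (j : ℕ) :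
    ∀ {f : ℕ} {N : Submodule R (Fin f → R)}, N.IsSplitAlong I J →
      TorVanishes (R := R) Y N (j + 2) → N = ⊥ ∨ HasPureFreePresentation I J Y := by
  induction j with
  | zero =>
    intro f N hN hTor
    obtain ⟨g, φ, hφ, hφm⟩ := IsLocalRing.exists_minimal_cover (R := R) N
    obtain ⟨h, ψ, hψ, hψm⟩ := IsLocalRing.exists_minimal_cover (R := R) (LinearMap.ker φ)
    have hr : LinearMap.range (N.subtype ∘ₗ φ) = N := by
      rw [LinearMap.range_comp, LinearMap.range_eq_top.2 hφ, Submodule.map_top,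
        Submodule.range_subtype]
    have hk : LinearMap.ker (N.subtype ∘ₗ φ) = LinearMap.ker φ :=
      LinearMap.ker_comp_of_ker_eq_bot _ N.ker_subtype
    have hr' : LinearMap.range ((LinearMap.ker φ).subtype ∘ₗ ψ) = LinearMap.ker φ := by
      rw [LinearMap.range_comp, LinearMap.range_eq_top.2 hψ, Submodule.map_top,
        Submodule.range_subtype]
    have hk' : LinearMap.ker ((LinearMap.ker φ).subtype ∘ₗ ψ) = LinearMap.ker ψ :=
      LinearMap.ker_comp_of_ker_eq_bot _ (LinearMap.ker φ).ker_subtype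
    have := range_eq_bot_or_hasPureFreePresentation hIJ hI hJ hJY
      ((LinearMap.ker φ).subtype ∘ₗ ψ) (N.subtype ∘ₗ φ) (hr'.trans hk.symm)
      (LinearMap.isSplitAlong_ker _ hIJ hsup
        (hk' ▸ fun x hx => Ideal.mem_finPow.2 (hψm x hx)))
      (by
        rw [hr', ← hk]
        exact LinearMap.isSplitAlong_ker _ hIJ hsup
          (hk ▸ fun x hx => Ideal.mem_finPow.2 (hφm x hx)))
      (by rwa [hr])
      (by rw [hk']; exact (hTor.ker φ hφ).lTensor_injective ψ hψ)
    rwa [hr] at this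
  | succ j ih =>
    intro f N hN hTor
    obtain ⟨g, φ, hφ, hφm⟩ := IsLocalRing.exists_minimal_cover (R := R) N
    have hr : LinearMap.range (N.subtype ∘ₗ φ) = N := by
      rw [LinearMap.range_comp, LinearMap.range_eq_top.2 hφ, Submodule.map_top,
        Submodule.range_subtype]
    have hk : LinearMap.ker (N.subtype ∘ₗ φ) = LinearMap.ker φ :=
      LinearMap.ker_comp_of_ker_eq_bot _ N.ker_subtype
    have hs : (LinearMap.ker φ).IsSplitAlong I J := by
      rw [← hk]
      exact LinearMap.isSplitAlong_ker _ hIJ hsup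
        (hk ▸ fun x hx => Ideal.mem_finPow.2 (hφm x hx))
    refine (ih hs (hTor.ker φ hφ)).imp_left fun h => ?_
    rw [← hr] at hN ⊢
    exact hN.range_eq_bot hIJ hI hJ (hk.trans h)

/-- If `Tor_m (Y, M) = 0` with `m ≥ 4`, then the first syzygy of `M` is free, apart from the
exceptional case. -/
lemma exists_minimal_resolution_of_torVanishes (hIJ : I ⊓ J = ⊥)
    (hsup : I ⊔ J = IsLocalRing.maximalIdeal R)
    (hI : I ≠ ⊥) (hJ : J ≠ ⊥) (hJY : ∀ j ∈ J, ∀ y : Y, j • y = 0)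
    (M : Type u) [AddCommGroup M] [Module R M] [Module.Finite R M]
    {m : ℕ} (hm : 4 ≤ m) (hTor : TorVanishes (R := R) Y M m) :
    (∃ (n p : ℕ) (φ : (Fin n → R) →ₗ[R] M) (_ : (Fin p → R) ≃ₗ[R] LinearMap.ker φ),
      Function.Surjective φ ∧ ∀ x ∈ LinearMap.ker φ, ∀ i, x i ∈ IsLocalRing.maximalIdeal R) ∨
    HasPureFreePresentation I J Y := by
  obtain ⟨j, rfl⟩ := Nat.exists_eq_add_of_le' hm
  obtain ⟨n, φ, hφ, hφm⟩ := IsLocalRing.exists_minimal_cover (R := R) M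
  obtain ⟨p, ψ, hψ, hψm⟩ := IsLocalRing.exists_minimal_cover (R := R) (LinearMap.ker φ)
  have hk' : LinearMap.ker ((LinearMap.ker φ).subtype ∘ₗ ψ) = LinearMap.ker ψ :=
    LinearMap.ker_comp_of_ker_eq_bot _ (LinearMap.ker φ).ker_subtype
  have hs : (LinearMap.ker ψ).IsSplitAlong I J := by
    rw [← hk']
    exact LinearMap.isSplitAlong_ker _ hIJ hsup
      (hk' ▸ fun x hx => Ideal.mem_finPow.2 (hψm x hx))
  -- Splitting is available only from the second syzygy on, so two shifts are spent before the index
  -- `j + 2` is reached; hence the bound `4 ≤ m`.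
  refine (hs.eq_bot_of_torVanishes hIJ hsup hI hJ hJY j
    (((show TorVanishes Y M (j + 2 + 2) from hTor).ker φ hφ).ker ψ hψ)).imp_left fun h => ?_
  exact ⟨n, p, φ, LinearEquiv.ofBijective ψ ⟨LinearMap.ker_eq_bot.1 h, hψ⟩, hφ, hφm⟩

end FiberProduct

/-! ### Local rings with projective maximal ideal -/

section FreeMaximalIdeal

variable {A : Type u} [CommRing A] [IsLocalRing A] [IsNoetherianRing A]

/-- A Noetherian local ring whose maximal ideal is generated by a nonzerodivisor is a DVR. -/
lemma isDVR_of_maximalIdeal_eq_span (π : A)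
    (hspan : IsLocalRing.maximalIdeal A = Ideal.span {π}) (hreg : ∀ r : A, π * r = 0 → r = 0)
    (hA : ¬ IsField A) : IsDVR A := by
  have hpow : ∀ (n : ℕ) (r : A), π ^ n * r = 0 → r = 0 := by
    intro n
    induction n with
    | zero => intro r hr; simpa using hr
    | succ n ih => intro r hr; exact ih r (hreg _ (by rw [← hr]; ring))
  -- By Krull's intersection theorem there is a largest power of the maximal ideal containing `x`;
  -- its exponent is `n`.
  have hfac : ∀ x : A, x ≠ 0 → ∃ (n : ℕ) (u : A), IsUnit u ∧ x = π ^ n * u := by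
    classical
    intro x hx
    have hex : ∃ n : ℕ, x ∉ IsLocalRing.maximalIdeal A ^ (n + 1) := by
      by_contra! h
      apply hx
      have : x ∈ ⨅ i : ℕ, IsLocalRing.maximalIdeal A ^ i := by
        rw [Submodule.mem_iInf]
        intro i
        cases i with
        | zero => simp
        | succ i => exact h i
      rwa [Ideal.iInf_pow_eq_bot_of_isLocalRing _ (Ideal.IsPrime.ne_top'), Ideal.mem_bot] at this
    obtain ⟨n, hn, hmin⟩ : ∃ n : ℕ, x ∉ IsLocalRing.maximalIdeal A ^ (n + 1) ∧
        x ∈ IsLocalRing.maximalIdeal A ^ n := by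
      refine ⟨Nat.find hex, Nat.find_spec hex, ?_⟩
      have := @Nat.find_min _ _ hex
      generalize Nat.find hex = n at *
      cases n with
      | zero => simp
      | succ n => simpa using this (Nat.lt_succ_self n)
    rw [hspan, Ideal.span_singleton_pow, Ideal.mem_span_singleton] at hmin
    obtain ⟨u, hu⟩ := hmin
    refine ⟨n, u, ?_, hu⟩
    by_contra hun
    have hum : u ∈ IsLocalRing.maximalIdeal A := hun
    refine hn ?_
    rw [hu, pow_succ]
    refine Ideal.mul_mem_mul (Ideal.pow_mem_pow ?_ n) hum
    rw [hspan]
    exact Ideal.mem_span_singleton_self π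
  have : NoZeroDivisors A := ⟨by
    intro x y hxy
    by_contra! h
    obtain ⟨n, u, hu, rfl⟩ := hfac x h.1
    obtain ⟨k, v, hv, rfl⟩ := hfac y h.2
    have := hpow (n + k) (u * v) (by rw [← hxy]; ring)
    exact (hu.mul hv).ne_zero this⟩
  have hdom : IsDomain A := NoZeroDivisors.to_isDomain A
  refine ⟨hdom, ((IsDiscreteValuationRing.TFAE A hA).out 0 4).2 ?_⟩
  exact ⟨π, hspan⟩

lemma isDVR_of_projective_maximalIdeal [Module.Projective A (IsLocalRing.maximalIdeal A)]
    (hA : ¬ IsField A) : IsDVR A := by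
  have hfree : Module.Free A (IsLocalRing.maximalIdeal A) := Module.free_of_flat_of_isLocalRing
  let b := Module.Free.chooseBasis A (IsLocalRing.maximalIdeal A)
  have hreg : ∀ i (r : A), (b i : A) * r = 0 → r = 0 := by
    intro i r hr
    have h0 : r • b i = 0 := Subtype.ext (by simpa [mul_comm] using hr)
    simpa using DFunLike.congr_fun (congrArg b.repr h0) i
  have hss : Subsingleton (Module.Free.ChooseBasisIndex A (IsLocalRing.maximalIdeal A)) := by
    refine ⟨fun i j => ?_⟩
    by_contra hij
    -- Two distinct basis elements of an ideal always satisfy this nontrivial relation, so the rank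
    -- is at most one.
    have h0 : (b j : A) • b i = (b i : A) • b j := Subtype.ext (mul_comm _ _)
    have h1 := DFunLike.congr_fun (congrArg b.repr h0) i
    simp [Ne.symm hij] at h1
    exact b.ne_zero j h1
  have hne : Nonempty (Module.Free.ChooseBasisIndex A (IsLocalRing.maximalIdeal A)) := by
    by_contra hemp
    rw [not_nonempty_iff] at hemp
    have hsub : Subsingleton (IsLocalRing.maximalIdeal A) := b.repr.toEquiv.subsingleton
    exact hA (IsLocalRing.isField_iff_maximalIdeal_eq.2
      (Submodule.subsingleton_iff_eq_bot.1 hsub))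
  obtain ⟨i⟩ := hne
  refine isDVR_of_maximalIdeal_eq_span (b i : A) ?_ (hreg i) hA
  refine le_antisymm (fun x hx => ?_) ((Ideal.span_singleton_le_iff_mem _).2 (b i).2)
  rw [Ideal.mem_span_singleton]
  have := b.sum_repr ⟨x, hx⟩
  rw [Fintype.sum_subsingleton _ i] at this
  exact ⟨b.repr ⟨x, hx⟩ i, by rw [mul_comm]; exact (congrArg Subtype.val this).symm⟩

end FreeMaximalIdeal

/-! ### Consequences of the exceptional presentation -/

section PureFreePresentation

open TensorProduct

variable {R : Type u} [CommRing R] {I J : Ideal R} {Y : Type u} [AddCommGroup Y] [Module R Y]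

/-- Since `R / I ≅ T` and `J` maps isomorphically onto the maximal ideal of `T`, the map `d` induces
an isomorphism from `Tʰ` to `g` copies of that ideal. As `g > 0`, the ideal is a direct summand of a
free module. -/
lemma HasPureFreePresentation.isDVR (H : HasPureFreePresentation I J Y) (hIJ : I ⊓ J = ⊥)
    {T : Type u} [CommRing T] [IsLocalRing T] [IsNoetherianRing T] (q : R →+* T)
    (hq : Function.Surjective q) (hqI : RingHom.ker q = I)
    (hqJ : ∀ j ∈ J, q j ∈ IsLocalRing.maximalIdeal T)
    (hJ : ∀ t ∈ IsLocalRing.maximalIdeal T, ∃ j ∈ J, q j = t) (hT : ¬ IsField T) :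
    IsDVR T := by
  obtain ⟨h, g, d, hg, hker, hran, -⟩ := H
  have hdJ : ∀ x k, d x k ∈ J := fun x =>
    Ideal.mem_finPow.1 (hran ▸ (⟨x, rfl⟩ : d x ∈ LinearMap.range d))
  let ψ : (Fin h → T) →ₗ[T] (Fin g → IsLocalRing.maximalIdeal T) :=
    Fintype.linearCombination T fun i k => ⟨q (d (Pi.single i 1) k), hqJ _ (hdJ _ _)⟩
  have hψ : ∀ x k, (ψ (fun i => q (x i)) k : T) = q (d x k) := by
    intro x k
    rw [d.apply_eq_sum_smul_single, Fintype.linearCombination_apply]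
    simp
  have hinj : Function.Injective ψ := by
    rw [injective_iff_map_eq_zero]
    intro t ht
    choose x hx using fun i => hq (t i)
    obtain rfl : (fun i => q (x i)) = t := funext hx
    have h1 : x ∈ LinearMap.ker d := by
      rw [LinearMap.mem_ker]
      ext k
      have : d x k ∈ I ⊓ J := ⟨by
        rw [SetLike.mem_coe, ← hqI, RingHom.mem_ker, ← hψ, ht]; rfl, hdJ x k⟩
      rwa [hIJ] at this
    rw [hker, Ideal.mem_finPow, ← hqI] at h1
    exact funext h1
  have hsurj : Function.Surjective ψ := by
    intro y
    choose x hxJ hx using fun k => hJ _ (y k).2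
    obtain ⟨z, hz⟩ : x ∈ LinearMap.range d := hran ▸ Ideal.mem_finPow.2 hxJ
    refine ⟨fun i => q (z i), funext fun k => Subtype.ext ?_⟩
    rw [hψ, hz, hx]
  have : Module.Projective T (Fin g → IsLocalRing.maximalIdeal T) :=
    Module.Projective.of_equiv (LinearEquiv.ofBijective ψ ⟨hinj, hsurj⟩)
  have : Module.Projective T (IsLocalRing.maximalIdeal T) :=
    Module.Projective.of_split
      (LinearMap.single T (fun _ : Fin g => IsLocalRing.maximalIdeal T) ⟨0, hg⟩)
      (LinearMap.proj ⟨0, hg⟩) (by ext; simp)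
  exact isDVR_of_projective_maximalIdeal hT

/-- `J ≠ ⊥` and `g > 0` force `h > 0`, so `I` is a retract of `Iʰ` and inherits injectivity. -/
lemma HasPureFreePresentation.lTensor_subtype_injective (H : HasPureFreePresentation I J Y)
    (hJ : J ≠ ⊥) : Function.Injective (I.subtype.lTensor Y) := by
  obtain ⟨h, g, d, hg, hker, hran, hinj⟩ := H
  have hh : 0 < h := by
    by_contra hh
    obtain rfl : h = 0 := by omega
    refine hJ (eq_bot_iff.2 fun j hj => ?_)
    have h1 : (fun _ => j) ∈ LinearMap.range d := hran ▸ Ideal.mem_finPow.2 fun _ => hj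
    obtain ⟨x, hx⟩ := h1
    rw [Subsingleton.elim x 0, map_zero] at hx
    exact (congrFun hx ⟨0, hg⟩).symm
  let s : I →ₗ[R] I.finPow h :=
    (LinearMap.single R (fun _ : Fin h => R) ⟨0, hh⟩ ∘ₗ I.subtype).codRestrict _ (by
      intro x
      refine Ideal.mem_finPow.2 fun i => ?_
      by_cases hi : i = ⟨0, hh⟩
      · subst hi; simp
      · simp [hi])
  let r : I.finPow h →ₗ[R] I :=
    (LinearMap.proj ⟨0, hh⟩ ∘ₗ (I.finPow h).subtype).codRestrict _
      fun x => Ideal.mem_finPow.1 x.2 _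
  have hrs : r ∘ₗ s = LinearMap.id := by
    exact LinearMap.ext fun x => Subtype.ext
      (Pi.single_eq_same (M := fun _ : Fin h => R) ⟨0, hh⟩ (x : R))
  have hs : Function.Injective (s.lTensor Y) := by
    have : Function.LeftInverse (r.lTensor Y) (s.lTensor Y) := fun x => by
      rw [← LinearMap.comp_apply, ← LinearMap.lTensor_comp, hrs, LinearMap.lTensor_id]; rfl
    exact this.injective
  have hcomp : (I.finPow h).subtype ∘ₗ s =
      LinearMap.single R (fun _ : Fin h => R) ⟨0, hh⟩ ∘ₗ I.subtype := rfl
  have h2 := hinj.comp hs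
  rw [← LinearMap.coe_comp, ← LinearMap.lTensor_comp, hcomp, LinearMap.lTensor_comp,
    LinearMap.coe_comp] at h2
  exact h2.of_comp

/-- The injective map `Y ⊗ I → Y` factors through a surjection onto `𝔪 ⊗ Y` over `S`, where `𝔪` is
the maximal ideal of `S`. So `𝔪 ⊗ Y → Y` is injective, the local criterion for freeness. -/
lemma Module.free_of_lTensor_subtype_injective {S : Type u} [CommRing S] [IsLocalRing S]
    [IsNoetherianRing S] [Algebra R S] [Module S Y] [IsScalarTower R S Y] [Module.Finite S Y]
    (hI : ∀ i ∈ I, algebraMap R S i ∈ IsLocalRing.maximalIdeal S)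
    (hI' : ∀ s ∈ IsLocalRing.maximalIdeal S, ∃ i ∈ I, algebraMap R S i = s)
    (hinj : Function.Injective (I.subtype.lTensor Y)) : Module.Free S Y := by
  have : Module.FinitePresentation S Y := Module.finitePresentation_of_finite S Y
  refine Module.free_of_maximalIdeal_rTensor_injective ?_
  let e : I →ₗ[R] IsLocalRing.maximalIdeal S :=
    { toFun := fun i => ⟨algebraMap R S i, hI i i.2⟩
      map_add' := fun a b => Subtype.ext (by simp)
      map_smul' := fun r a => Subtype.ext (by simp [Algebra.smul_def]) }
  have he : Function.Surjective e := by
    rintro ⟨s, hs⟩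
    obtain ⟨i, hi, rfl⟩ := hI' s hs
    exact ⟨⟨i, hi⟩, rfl⟩
  let Φ : Y ⊗[R] I → (IsLocalRing.maximalIdeal S) ⊗[S] Y := fun z =>
    TensorProduct.comm S Y _
      (TensorProduct.mapOfCompatibleSMul S R R Y (IsLocalRing.maximalIdeal S) (e.lTensor Y z))
  have hΦ : Function.Surjective Φ :=
    (TensorProduct.comm S Y _).surjective.comp
      ((TensorProduct.mapOfCompatibleSMul_surjective S R R Y _).comp
        (LinearMap.lTensor_surjective Y he))
  have hcomm : ∀ z, TensorProduct.lid S Y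
      ((IsLocalRing.maximalIdeal S).subtype.rTensor Y (Φ z)) =
      TensorProduct.rid R Y (I.subtype.lTensor Y z) := by
    intro z
    induction z with
    | zero => simp [Φ]
    | add a b ha hb =>
      simp only [Φ, map_add] at ha hb ⊢
      rw [ha, hb]
    | tmul y i => simp [Φ, e]
  intro a b hab
  obtain ⟨a, rfl⟩ := hΦ a
  obtain ⟨b, rfl⟩ := hΦ b
  refine congrArg Φ (hinj ((TensorProduct.rid R Y).injective ?_))
  rw [← hcomm, ← hcomm, hab]

end PureFreePresentation

/-! ### Socle elements in depth zero -/

section Depth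

variable {A : Type u} [CommRing A] [IsLocalRing A] [IsNoetherianRing A]

/-- In a Noetherian local ring of depth zero that is not a field, the maximal ideal contains a
nonzero element that it annihilates. -/
lemma exists_mem_maximalIdeal_of_localRingDepth_eq_zero (hA : ¬ IsField A)
    (h : localRingDepth A = 0) :
    ∃ s ∈ IsLocalRing.maximalIdeal A, s ≠ 0 ∧ ∀ r ∈ IsLocalRing.maximalIdeal A, s * r = 0 := by
  have hdisj : Disjoint (IsLocalRing.maximalIdeal A : Set A) (nonZeroDivisors A) := by
    rw [Set.disjoint_left]
    intro x hx hx'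
    have hmem : ∀ r ∈ [x], r ∈ IsLocalRing.maximalIdeal A := by simpa using hx
    have hreg : RingTheory.Sequence.IsRegular A [x] := by
      refine RingTheory.Sequence.IsRegular.of_isWeaklyRegular_of_mem_maximalIdeal A hmem ?_
      rw [RingTheory.Sequence.isWeaklyRegular_singleton_iff]
      intro a b hab
      exact (mul_cancel_left_mem_nonZeroDivisors hx').1 hab
    have : (([x] : List A).length : ℕ∞) ≤ localRingDepth A :=
      le_iSup_of_le [x] (le_iSup_of_le hmem (le_iSup_of_le hreg le_rfl))
    rw [h] at this
    simp at this
  obtain ⟨s, hs, hs0⟩ := Submodule.exists_mem_ne_zero_of_ne_bot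
    (Ideal.bot_lt_annihilator_of_disjoint_nonZeroDivisors hdisj).ne'
  have hann : ∀ r ∈ IsLocalRing.maximalIdeal A, s * r = 0 := fun r hr =>
    Submodule.mem_annihilator.1 hs r hr
  refine ⟨s, ?_, hs0, hann⟩
  by_contra hsu
  have hu : IsUnit s := by simpa using hsu
  refine hA (IsLocalRing.isField_iff_maximalIdeal_eq.2 (eq_bot_iff.2 fun r hr => ?_))
  exact hu.mul_right_eq_zero.1 (hann r hr)

end Depth

/-! ### Modules with free first syzygy -/

section Resolution

variable {R : Type u} [CommRing R] {M : Type u} [AddCommGroup M] [Module R M] {n p : ℕ}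

lemma projectiveDimension_le_one_of_ker_equiv (φ : (Fin n → R) →ₗ[R] M)
    (hφ : Function.Surjective φ) (e : (Fin p → R) ≃ₗ[R] LinearMap.ker φ) :
    projectiveDimension (ModuleCat.of R M) ≤ 1 := by
  refine (projectiveDimension_le_iff _ 1).2 ?_
  have : Module.Projective R (LinearMap.ker φ) := Module.Projective.of_equiv e
  have h₁ : Projective (ModuleCat.of R (LinearMap.ker φ)) := inferInstance
  have h₂ : Projective (ModuleCat.of R (Fin n → R)) := inferInstance
  exact ((φ.shortExact_ker hφ).hasProjectiveDimensionLT_X₃_iff 0 h₂).2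
    (projective_iff_hasProjectiveDimensionLT_one.1 h₁)

lemma free_of_ker_equiv_of_annihilates [IsLocalRing R] (φ : (Fin n → R) →ₗ[R] M)
    (hφ : Function.Surjective φ) (e : (Fin p → R) ≃ₗ[R] LinearMap.ker φ)
    (hm : ∀ x ∈ LinearMap.ker φ, ∀ i, x i ∈ IsLocalRing.maximalIdeal R) {s : R} (hs : s ≠ 0)
    (hsm : ∀ r ∈ IsLocalRing.maximalIdeal R, s * r = 0) : Module.Free R M := by
  have hempty : IsEmpty (Fin p) := by
    refine ⟨fun i => hs ?_⟩
    -- By minimality the kernel has entries in the maximal ideal, so `s` kills it, although it is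
    -- free and `s ≠ 0`.
    have h0 : s • (Pi.single i 1 : Fin p → R) = 0 := by
      apply e.injective
      rw [map_smul, map_zero]
      exact Subtype.ext (funext fun k => hsm _ (hm _ (e (Pi.single i 1)).2 k))
    simpa using congrFun h0 i
  have hsub : Subsingleton (LinearMap.ker φ) := e.symm.toEquiv.subsingleton
  exact Module.Free.of_equiv (LinearEquiv.ofBijective φ
    ⟨LinearMap.ker_eq_bot.1 (Submodule.subsingleton_iff_eq_bot.1 hsub), hφ⟩)

end Resolution

/-! ### The fiber product is Noetherian -/

section Pullback

/-- A module with an injective semilinear map to a Noetherian module along a surjective ring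
homomorphism is Noetherian. -/
lemma isNoetherian_of_injective_semilinear {A B M N : Type*} [CommRing A] [CommRing B]
    [AddCommGroup M] [AddCommGroup N] [Module A M] [Module B N] {σ : A →+* B}
    [RingHomSurjective σ] (f : M →ₛₗ[σ] N) (hf : Function.Injective f) [IsNoetherian B N] :
    IsNoetherian A M := by
  rw [isNoetherian_iff']
  have hN : WellFoundedGT (Submodule B N) := isNoetherian_iff'.1 inferInstance
  have hmono : StrictMono (Submodule.map f) :=
    Monotone.strictMono_of_injective (fun _ _ h => Submodule.map_mono h)
      (Submodule.map_injective_of_injective hf)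
  exact hmono.wellFoundedGT

variable {S T k : Type u} [CommRing S] [CommRing T] [Field k] (πS : S →+* k) (πT : T →+* k)

lemma RingHom.isNoetherianRing_pullback [IsNoetherianRing S] [IsNoetherianRing T]
    (hπS : Function.Surjective πS) (hπT : Function.Surjective πT) :
    IsNoetherianRing (πS.pullback πT) := by
  let qS := πS.pullbackFst πT
  let qT := πS.pullbackSnd πT
  have hqS : RingHomSurjective qS := ⟨πS.surjective_pullbackFst_of_surjective πT hπT⟩
  have hqT : RingHomSurjective qT := ⟨πS.surjective_pullbackSnd_of_surjective πT hπS⟩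
  let := Module.compHom S qS
  let := Module.compHom T qT
  have : IsNoetherian (πS.pullback πT) S :=
    isNoetherian_of_injective_semilinear (σ := qS)
      ({ toFun := fun x => x, map_add' := fun _ _ => rfl, map_smul' := fun _ _ => rfl } :
        S →ₛₗ[qS] S)
      (fun _ _ h => h)
  have : IsNoetherian (πS.pullback πT) T :=
    isNoetherian_of_injective_semilinear (σ := qT)
      ({ toFun := fun x => x, map_add' := fun _ _ => rfl, map_smul' := fun _ _ => rfl } :
        T →ₛₗ[qT] T)
      (fun _ _ h => h)
  let i₁ : (πS.pullback πT) →ₗ[πS.pullback πT] S :=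
    { toFun := qS, map_add' := map_add qS, map_smul' := map_mul qS }
  let i₂ : (πS.pullback πT) →ₗ[πS.pullback πT] T :=
    { toFun := qT, map_add' := map_add qT, map_smul' := map_mul qT }
  refine isNoetherian_of_injective (i₁.prod i₂) fun x y hxy => Subtype.ext ?_
  exact hxy

end Pullback

/-! ### The main theorem -/

theorem mainTheorem3
    {S T k : Type u} [CommRing S] [CommRing T] [Field k]
    [IsLocalRing S] [IsLocalRing T] [IsNoetherianRing S] [IsNoetherianRing T]
    (πS : S →+* k) (πT : T →+* k)
    (hπS : Function.Surjective πS) (hπT : Function.Surjective πT)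
    (hS : ¬ IsField S) (hT : ¬ IsField T)
    (M : Type u) [AddCommGroup M] [Module (πS.pullback πT) M] [Module.Finite (πS.pullback πT) M]
    (Y : Type u) [AddCommGroup Y] [Module S Y] [Module.Finite S Y] [Nontrivial Y]
    (m : ℕ) (hm : 4 ≤ m)
    (hTor : Limits.IsZero
      (((Tor (ModuleCat.{u} (πS.pullback πT)) m).obj
        ((ModuleCat.restrictScalars (πS.pullbackFst πT)).obj (ModuleCat.of S Y))).obj
          (ModuleCat.of (πS.pullback πT) M)))
    (hcond : ¬ IsDVR T ∨ ¬ Module.Free S Y) :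
    projectiveDimension (ModuleCat.of (πS.pullback πT) M) ≤ 1 ∧
      (localRingDepth S = 0 ∨ localRingDepth T = 0 → Module.Free (πS.pullback πT) M) := by
  have hkS : RingHom.ker πS = IsLocalRing.maximalIdeal S :=
    IsLocalRing.eq_maximalIdeal (RingHom.ker_isMaximal_of_surjective πS hπS)
  have hkT : RingHom.ker πT = IsLocalRing.maximalIdeal T :=
    IsLocalRing.eq_maximalIdeal (RingHom.ker_isMaximal_of_surjective πT hπT)
  have : IsLocalHom πS := hπS.isLocalHom
  have : IsLocalHom πT := hπT.isLocalHom
  have : IsLocalRing (πS.pullback πT) := RingHom.isLocalRing_pullback πS πT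
  have : IsNoetherianRing (πS.pullback πT) := RingHom.isNoetherianRing_pullback πS πT hπS hπT
  let qS : πS.pullback πT →+* S := πS.pullbackFst πT
  let qT : πS.pullback πT →+* T := πS.pullbackSnd πT
  have hqS : Function.Surjective qS := πS.surjective_pullbackFst_of_surjective πT hπT
  have hqT : Function.Surjective qT := πS.surjective_pullbackSnd_of_surjective πT hπS
  have hmS : ∀ r ∈ IsLocalRing.maximalIdeal (πS.pullback πT), qS r ∈ IsLocalRing.maximalIdeal S :=
    fun r hr hu => hr ((RingHom.isLocalHom_pullbackFst πS πT).map_nonunit r hu)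
  have hmT : ∀ r ∈ IsLocalRing.maximalIdeal (πS.pullback πT), qT r ∈ IsLocalRing.maximalIdeal T :=
    fun r hr hu => hr ((RingHom.isLocalHom_pullbackSnd πS πT).map_nonunit r hu)
  have hlS : ∀ s ∈ IsLocalRing.maximalIdeal S, ∃ r, qS r = s ∧ qT r = 0 := fun s hs =>
    ⟨⟨(s, 0), by
      change πS s = πT 0
      rw [map_zero]
      exact RingHom.mem_ker.1 (hkS ▸ hs)⟩, rfl, rfl⟩
  have hlT : ∀ t ∈ IsLocalRing.maximalIdeal T, ∃ r, qS r = 0 ∧ qT r = t := fun t ht =>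
    ⟨⟨(0, t), by
      change πS 0 = πT t
      rw [map_zero]
      exact (RingHom.mem_ker.1 (hkT ▸ ht)).symm⟩, rfl, rfl⟩
  have hext : ∀ r r' : πS.pullback πT, qS r = qS r' → qT r = qT r' → r = r' :=
    fun r r' h₁ h₂ => Subtype.ext (Prod.ext h₁ h₂)
  let I : Ideal (πS.pullback πT) := RingHom.ker qT
  let J : Ideal (πS.pullback πT) := RingHom.ker qS
  have hIm : I ≤ IsLocalRing.maximalIdeal (πS.pullback πT) :=
    IsLocalRing.le_maximalIdeal (RingHom.ker_ne_top qT)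
  have hJm : J ≤ IsLocalRing.maximalIdeal (πS.pullback πT) :=
    IsLocalRing.le_maximalIdeal (RingHom.ker_ne_top qS)
  have hIJ : I ⊓ J = ⊥ := eq_bot_iff.2 fun r hr =>
    hext r 0 (hr.2.trans (map_zero qS).symm) (hr.1.trans (map_zero qT).symm)
  have hsup : I ⊔ J = IsLocalRing.maximalIdeal (πS.pullback πT) := by
    refine le_antisymm (sup_le hIm hJm) fun r hr => ?_
    obtain ⟨a, ha, ha'⟩ := hlS _ (hmS r hr)
    obtain ⟨b, hb, hb'⟩ := hlT _ (hmT r hr)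
    have hrab : r = a + b :=
      hext _ _ (by rw [map_add, ha, hb, add_zero]) (by rw [map_add, ha', hb', zero_add])
    rw [hrab]
    exact Submodule.add_mem_sup ha' hb
  have hI : I ≠ ⊥ := by
    intro h
    refine hS (IsLocalRing.isField_iff_maximalIdeal_eq.2 (eq_bot_iff.2 fun s hs => ?_))
    obtain ⟨r, rfl, hr⟩ := hlS s hs
    have : r ∈ I := hr
    rw [h, Ideal.mem_bot] at this
    rw [this, map_zero]
    exact zero_mem _
  have hJ : J ≠ ⊥ := by
    intro h
    refine hT (IsLocalRing.isField_iff_maximalIdeal_eq.2 (eq_bot_iff.2 fun t ht => ?_))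
    obtain ⟨r, hr, rfl⟩ := hlT t ht
    have : r ∈ J := hr
    rw [h, Ideal.mem_bot] at this
    rw [this, map_zero]
    exact zero_mem _
  let : Algebra (πS.pullback πT) S := qS.toAlgebra
  let : Module (πS.pullback πT) Y := Module.compHom Y qS
  have : IsScalarTower (πS.pullback πT) S Y := ⟨fun r s y => mul_smul (qS r) s y⟩
  have : Module.Finite (πS.pullback πT) S :=
    Module.Finite.of_surjective (Algebra.linearMap (πS.pullback πT) S) hqS
  have : Module.Finite (πS.pullback πT) Y := Module.Finite.trans S Y
  have hJY : ∀ j ∈ J, ∀ y : Y, j • y = 0 := fun j hj y => by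
    change qS j • y = 0
    rw [RingHom.mem_ker.1 hj, zero_smul]
  rcases exists_minimal_resolution_of_torVanishes hIJ hsup hI hJ hJY M hm hTor with
    ⟨n, p, φ, e, hφ, hφm⟩ | H
  · refine ⟨projectiveDimension_le_one_of_ker_equiv φ hφ e, ?_⟩
    rintro (h | h)
    · obtain ⟨s, hs, hs0, hsm⟩ := exists_mem_maximalIdeal_of_localRingDepth_eq_zero hS h
      obtain ⟨a, rfl, ha⟩ := hlS s hs
      -- The lift `a = (s, 0)` annihilates the maximal ideal of the fiber product, checked in each
      -- coordinate.
      refine free_of_ker_equiv_of_annihilates φ hφ e hφm (s := a) (fun h0 => hs0 ?_) fun r hr => ?_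
      · rw [h0, map_zero]
      · exact hext _ _ (by rw [map_mul, hsm _ (hmS r hr), map_zero])
          (by rw [map_mul, ha, zero_mul, map_zero])
    · obtain ⟨t, ht, ht0, htm⟩ := exists_mem_maximalIdeal_of_localRingDepth_eq_zero hT h
      obtain ⟨a, ha, rfl⟩ := hlT t ht
      refine free_of_ker_equiv_of_annihilates φ hφ e hφm (s := a) (fun h0 => ht0 ?_) fun r hr => ?_
      · rw [h0, map_zero]
      · exact hext _ _ (by rw [map_mul, ha, zero_mul, map_zero])
          (by rw [map_mul, htm _ (hmT r hr), map_zero])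
  -- The exceptional presentation makes `T` a DVR and `Y` free simultaneously, violating both
  -- alternatives of `hcond`.
  · exfalso
    have hDVR : IsDVR T := H.isDVR hIJ qT hqT rfl (fun j hj => hmT j (hJm hj))
      (fun t ht => by
        obtain ⟨r, hr, hrt⟩ := hlT t ht
        exact ⟨r, hr, hrt⟩) hT
    have hfree : Module.Free S Y :=
      Module.free_of_lTensor_subtype_injective (R := πS.pullback πT) (I := I)
        (fun i hi => hmS i (hIm hi))
        (fun s hs => by
          obtain ⟨r, hr, hrs⟩ := hlS s hs
          exact ⟨r, hrs, hr⟩)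
        (H.lTensor_subtype_injective hJ)
    exact hcond.elim (fun h => h hDVR) (fun h => h hfree)
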